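/- For $\gamma\in[0,1]$ let $\mathcal{P}_\gamma$ be the qubit dephasing channel $\mathcal{P}_\gamma(\rho)=K_0\rho K_0^\dagger+K_1\rho K_1^\dagger$ with Kraus operators $K_0=\begin{pmatrix}1&0\\0&\sqrt{1-\gamma}\end{pmatrix}$ and $K_1=\begin{pmatrix}0&0\\0&\sqrt{\gamma}\end{pmatrix}$. For a two-qubit density operator $\rho$ and observables $O^A_x$, $O^B_y$ ($x,y\in\{0,1\}$) on the first and the second qubit, each of the form $\Pi_{+}-\Pi_{-}$ for a projection-valued measure $\{\Pi_{+},\Pi_{-}\}$ on one qubit, the CHSH score in the presence of the noise $\mathcal{P}_{\gamma_1}\otimes\mathcal{P}_{\gamma_2}$ is $$S_{\mathrm{CHSH}}=\Big|\sum_{x,y=0}^{1}(-1)^{xy}\,\mathrm{Tr}\big[(O^A_x\otimes O^B_y)\,(\mathcal{P}_{\gamma_1}\otimes\mathcal{P}_{\gamma_2})(\rho)\big]\Big|.$$ For all $\gamma_1,\gamma_2\in[0,1]$, the maximum of $S_{\mathrm{CHSH}}$ over all two-qubit density operators $\rho$ and all such observables $O^A_0,O^A_1,O^B_0,O^B_1$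 exists and equals $$S^\star_{\mathrm{CHSH}}=2\sqrt{1+(1-\gamma_1)(1-\gamma_2)}.$$ -/

import Mathlib

open scoped Kronecker ComplexOrder

/-- A single-qubit operator, in the computational basis `|0⟩, |1⟩`. -/
abbrev QubitOp : Type := Matrix (Fin 2) (Fin 2) ℂ

/-- A two-qubit operator, in the computational basis `|i⟩ ⊗ |j⟩`, indexed by `(i, j)`. -/
abbrev TwoQubitOp : Type := Matrix (Fin 2 × Fin 2) (Fin 2 × Fin 2) ℂ

/-- Density operators: positive semidefinite matrices of unit trace. -/
def IsDensityOperator {n : Type*} [Fintype n] (ρ : Matrix n n ℂ) : Prop :=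
  ρ.PosSemidef ∧ ρ.trace = 1

/-- The map `ρ ↦ ∑ i, K i * ρ * (K i)ᴴ` with Kraus operators `K i`. -/
noncomputable def krausMap {ι n : Type*} [Fintype ι] [Fintype n] (K : ι → Matrix n n ℂ) :
    Matrix n n ℂ →ₗ[ℂ] Matrix n n ℂ where
  toFun ρ := ∑ i, K i * ρ * (K i).conjTranspose
  map_add' ρ τ := by simp [mul_add, add_mul, Finset.sum_add_distrib]
  map_smul' c ρ := by simp [Finset.smul_sum]

/-- The Kraus operators `diag(1, √(1 - γ))` and `diag(0, √γ)` of qubit dephasing. -/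
noncomputable def dephasingKraus (γ : ℝ) : Fin 2 → QubitOp :=
  ![!![1, 0; 0, (Real.sqrt (1 - γ) : ℂ)], !![0, 0; 0, (Real.sqrt γ : ℂ)]]

/-- The qubit dephasing channel `𝒫_γ`. -/
noncomputable def dephasing (γ : ℝ) : QubitOp →ₗ[ℂ] QubitOp :=
  krausMap (dephasingKraus γ)

/-- The tensor product `Φ ⊗ Ψ` of two linear maps on matrices: the linear map with
`(Φ ⊗ Ψ) (X ⊗ Y) = Φ X ⊗ Ψ Y`, where the tensor product of matrices is the Kronecker product. -/
noncomputable def tensorMap {n m : Type*} [Fintype n] [Fintype m] [DecidableEq n] [DecidableEq m]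
    (Φ : Matrix n n ℂ →ₗ[ℂ] Matrix n n ℂ) (Ψ : Matrix m m ℂ →ₗ[ℂ] Matrix m m ℂ) :
    Matrix (n × m) (n × m) ℂ →ₗ[ℂ] Matrix (n × m) (n × m) ℂ :=
  (kroneckerLinearEquiv n n m m ℂ).toLinearMap ∘ₗ TensorProduct.map Φ Ψ ∘ₗ
    (kroneckerLinearEquiv n n m m ℂ).symm.toLinearMap

/-- A projection-valued measure with finite outcome set `α`. -/
structure PVM (α n : Type*) [Fintype α] [Fintype n] [DecidableEq n] where
  /-- the projector of an outcome -/
  proj : α → Matrix n n ℂ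
  isHermitian : ∀ a, (proj a).IsHermitian
  idempotent : ∀ a, proj a * proj a = proj a
  orthogonal : ∀ a b, a ≠ b → proj a * proj b = 0
  sum_eq_one : ∑ a, proj a = 1

/-- The observable `∑ a, a Π_a` of a measurement with outcomes `a ∈ {1, -1} = ℤˣ`. -/
noncomputable def PVM.observable {n : Type*} [Fintype n] [DecidableEq n] (M : PVM ℤˣ n) :
    Matrix n n ℂ :=
  ∑ a : ℤˣ, ((a : ℤ) : ℂ) • M.proj a

/-- The correlator `⟨O^A O^B⟩_ρ = Tr[(O^A ⊗ O^B) ρ]`. -/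
noncomputable def correlator (ρ : TwoQubitOp) (A B : PVM ℤˣ (Fin 2)) : ℂ :=
  ((A.observable ⊗ₖ B.observable) * ρ).trace

/-- The CHSH score `|∑_{x,y} (-1)^{xy} ⟨O^A_x O^B_y⟩_ρ|` of the state `ρ` with the local qubit
measurements `A x` and `B y`, where `x, y ∈ {0, 1}`. -/
noncomputable def chshScore (ρ : TwoQubitOp) (A B : Fin 2 → PVM ℤˣ (Fin 2)) : ℝ :=
  ‖∑ x : Fin 2, ∑ y : Fin 2, (-1 : ℂ) ^ (x.val * y.val) * correlator ρ (A x) (B y)‖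

/-- The CHSH scores attainable when the noise `𝒩` acts on the two-qubit state before the
measurements: all state preparations and all local measurements are allowed. -/
def chshScores (𝒩 : TwoQubitOp →ₗ[ℂ] TwoQubitOp) : Set ℝ :=
  {S | ∃ ρ : TwoQubitOp, IsDensityOperator ρ ∧
    ∃ A B : Fin 2 → PVM ℤˣ (Fin 2), S = chshScore (𝒩 ρ) A B}

/-! Dephasing multiplies off-diagonal entries by `s = √(1 - γ)`. This operation can be moved from
the state to the observables, where it acts on Bloch vectors as `D_s = diag(s, s, 1)`
(`blochScale`). If some side has commuting observables, the score obeys the classical bound 2.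
Otherwise all four observables are Pauli observables along unit vectors, and the score is the
absolute value of a form in `M = D_s R D_t`, where the correlation matrix `R` is a contraction.

With `p = b₀ + b₁` and `q = b₀ - b₁`, orthogonal with `|p|² + |q|² = 4`, the form is `a₀ · M p + a₁
· M q`. By Cauchy–Schwarz it suffices that `|M p̂|² + |M q̂|² ≤ 1 + s²t²` for orthonormal `p̂`, `q̂`
(`scaled_image_bound`, `chsh_vector_bound`). The Bell state, with `M = diag(st, -st, 1)`, attains
the bound. -/

open Matrix

/-! ### Qubit observables and Bloch vectors. -/

/-- The Hermitian operator `v 0 X + v 1 Y + v 2 Z`. -/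
noncomputable def pauliVec (v : Fin 3 → ℝ) : QubitOp :=
  !![(v 2 : ℂ), v 0 - v 1 * Complex.I; v 0 + v 1 * Complex.I, -(v 2 : ℂ)]

lemma pauliVec_isHermitian (v : Fin 3 → ℝ) : (pauliVec v).IsHermitian := by
  ext i j
  fin_cases i <;> fin_cases j <;> simp [pauliVec, sub_eq_add_neg]

lemma pauliVec_mul_self (v : Fin 3 → ℝ) :
    pauliVec v * pauliVec v = ((v ⬝ᵥ v : ℝ) : ℂ) • (1 : QubitOp) := by
  ext i j
  fin_cases i <;> fin_cases j <;>
    simp [pauliVec, Matrix.mul_apply, Fin.sum_univ_succ, dotProduct] <;> ring_nf <;>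
    simp

lemma sum_int_units {M : Type*} [AddCommMonoid M] (f : ℤˣ → M) : ∑ a, f a = f 1 + f (-1) := by
  rw [show (Finset.univ : Finset ℤˣ) = {1, -1} by decide, Finset.sum_pair (by decide)]

lemma PVM.observable_eq {n : Type*} [Fintype n] [DecidableEq n] (M : PVM ℤˣ n) :
    M.observable = M.proj 1 - M.proj (-1) := by
  simp [PVM.observable, sub_eq_add_neg]

lemma PVM.observable_isHermitian {n : Type*} [Fintype n] [DecidableEq n] (M : PVM ℤˣ n) :
    M.observable.IsHermitian := by
  rw [M.observable_eq]
  exact (M.isHermitian 1).sub (M.isHermitian (-1))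

lemma PVM.observable_mul_self {n : Type*} [Fintype n] [DecidableEq n] (M : PVM ℤˣ n) :
    M.observable * M.observable = 1 := by
  rw [M.observable_eq, mul_sub, sub_mul, sub_mul, M.idempotent, M.idempotent,
    M.orthogonal 1 (-1) (by decide), M.orthogonal (-1) 1 (by decide), ← M.sum_eq_one,
    sum_int_units]
  simp

/-- A Hermitian involution on one qubit is `±1` or a unit combination of Pauli matrices. -/
lemma exists_pauliVec_of_mul_self_eq_one {O : QubitOp} (hO : O.IsHermitian) (h : O * O = 1) :
    (∃ v : Fin 3 → ℝ, v ⬝ᵥ v = 1 ∧ O = pauliVec v) ∨ O = 1 ∨ O = -1 := by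
  obtain ⟨a, ha⟩ : ∃ a : ℝ, O 0 0 = a := ⟨(O 0 0).re, (Complex.conj_eq_iff_re.mp (hO.apply 0 0)).symm⟩
  obtain ⟨d, hd⟩ : ∃ d : ℝ, O 1 1 = d := ⟨(O 1 1).re, (Complex.conj_eq_iff_re.mp (hO.apply 1 1)).symm⟩
  obtain ⟨x, y, hxy⟩ : ∃ x y : ℝ, O 0 1 = x - y * Complex.I :=
    ⟨(O 0 1).re, -(O 0 1).im, by simp⟩
  have hyx : O 1 0 = x + y * Complex.I := by
    rw [← hO.apply 1 0, hxy]
    simp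
  have e : O = !![(a : ℂ), x - y * Complex.I; x + y * Complex.I, (d : ℂ)] := by
    rw [← ha, ← hd, ← hxy, ← hyx]
    exact Matrix.eta_fin_two O
  have h00 := congr_fun₂ h 0 0
  have h11 := congr_fun₂ h 1 1
  have h01 := congr_fun₂ h 0 1
  rw [e] at h00 h11 h01
  simp [Matrix.mul_apply, Complex.ext_iff] at h00 h11 h01
  -- The off-diagonal entries of `O * O` are those of `O` times the trace `a + d`. Nonzero trace
  -- thus forces `O` to be diagonal.
  by_cases had : a + d = 0
  · refine Or.inl ⟨![x, y, a], ?_, ?_⟩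
    · simp [dotProduct, Fin.sum_univ_succ]
      linarith [h00.1]
    · rw [e, pauliVec, eq_neg_of_add_eq_zero_right had]
      simp
  · have hx : x = 0 := by
      have : x * (a + d) = 0 := by linarith [h01.1]
      simpa [had] using this
    have hy : y = 0 := by
      have : y * (a + d) = 0 := by linarith [h01.2]
      simpa [had] using this
    subst hx hy
    have e1 : a ^ 2 = 1 := by linarith [h00.1]
    have e2 : d ^ 2 = 1 := by linarith [h11.1]
    refine Or.inr ?_
    have hda : d = a := by
      have : (d - a) * (a + d) = 0 := by linarith
      exact sub_eq_zero.mp ((mul_eq_zero.mp this).resolve_right had)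
    subst hda
    rcases mul_self_eq_one_iff.mp (by linarith : d * d = 1) with h1 | h1
    · exact Or.inl (by rw [e, h1, Matrix.one_fin_two]; simp)
    · exact Or.inr (by rw [e, h1, Matrix.one_fin_two]; simp)

/-- The projective measurement of the Pauli observable along a unit vector. -/
noncomputable def pauliPVM (v : Fin 3 → ℝ) (hv : v ⬝ᵥ v = 1) : PVM ℤˣ (Fin 2) where
  proj a := (1 / 2 : ℂ) • (1 + ((a : ℤ) : ℂ) • pauliVec v)
  isHermitian a := by
    have h := (pauliVec_isHermitian v).eq
    simp [Matrix.IsHermitian, Matrix.conjTranspose_smul, h]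
  idempotent a := by
    have h := pauliVec_mul_self v
    rw [hv] at h
    rcases Int.units_eq_one_or a with rfl | rfl <;>
    · simp [mul_add, add_mul, h, smul_smul]
      module
  orthogonal a b hab := by
    have h := pauliVec_mul_self v
    rw [hv] at h
    rcases Int.units_eq_one_or a with rfl | rfl <;> rcases Int.units_eq_one_or b with rfl | rfl <;>
    · simp [mul_add, add_mul, h, smul_smul] at hab ⊢
      try module
  sum_eq_one := by
    rw [sum_int_units]
    simp
    module

lemma pauliPVM_observable (v : Fin 3 → ℝ) (hv : v ⬝ᵥ v = 1) :
    (pauliPVM v hv).observable = pauliVec v := by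
  simp [PVM.observable_eq, pauliPVM]
  module

/-! ### Dephasing as entrywise multiplication. -/

/-- The multiplier of the off-diagonal entries. -/
noncomputable def dephasingMultiplier (s : ℝ) : QubitOp := !![1, (s : ℂ); (s : ℂ), 1]

/-- Only the first Kraus operator reaches the off-diagonal entries; on the last diagonal entry the
weights `1 - γ` and `γ` add up to 1. -/
lemma dephasing_apply {γ : ℝ} (hγ : γ ∈ Set.Icc (0 : ℝ) 1) (X : QubitOp) :
    dephasing γ X = dephasingMultiplier (Real.sqrt (1 - γ)) ⊙ X := by
  have h1 : (Real.sqrt (1 - γ) : ℂ) * Real.sqrt (1 - γ) = 1 - γ := by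
    rw [← Complex.ofReal_mul, Real.mul_self_sqrt (by linarith [hγ.2])]; simp
  have h2 : (Real.sqrt γ : ℂ) * Real.sqrt γ = γ := by
    rw [← Complex.ofReal_mul, Real.mul_self_sqrt hγ.1]
  have hK (c d : ℝ) : (!![(c : ℂ), 0; 0, (d : ℂ)] : QubitOp)ᴴ = !![(c : ℂ), 0; 0, (d : ℂ)] := by
    ext i j
    fin_cases i <;> fin_cases j <;> simp
  have hK₀ := hK 1 (Real.sqrt (1 - γ))
  have hK₁ := hK 0 (Real.sqrt γ)
  simp only [Complex.ofReal_one, Complex.ofReal_zero] at hK₀ hK₁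
  rw [Matrix.eta_fin_two X]
  simp only [dephasing, krausMap, LinearMap.coe_mk, AddHom.coe_mk, Fin.sum_univ_two,
    dephasingKraus, Matrix.cons_val_zero, Matrix.cons_val_one, hK₀, hK₁, Matrix.mul_fin_two]
  ext i j
  fin_cases i <;> fin_cases j <;> simp [dephasingMultiplier]
  · ring
  · linear_combination X 1 1 * (h1 + h2)

lemma tensorMap_eq_hadamard {n m : Type*} [Fintype n] [Fintype m] [DecidableEq n] [DecidableEq m]
    {Φ : Matrix n n ℂ →ₗ[ℂ] Matrix n n ℂ} {Ψ : Matrix m m ℂ →ₗ[ℂ] Matrix m m ℂ}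
    {V : Matrix n n ℂ} {W : Matrix m m ℂ} (hΦ : ∀ X, Φ X = V ⊙ X) (hΨ : ∀ X, Ψ X = W ⊙ X)
    (ρ : Matrix (n × m) (n × m) ℂ) : tensorMap Φ Ψ ρ = (V ⊗ₖ W) ⊙ ρ := by
  obtain ⟨x, rfl⟩ := (kroneckerLinearEquiv n n m m ℂ).surjective ρ
  induction x using TensorProduct.induction_on with
  | zero => simp
  | add x y hx hy => simp [hx, hy, Matrix.hadamard_add]
  | tmul X Y =>
    ext ⟨i, j⟩ ⟨k, l⟩
    simp [tensorMap, hΦ, hΨ, Matrix.hadamard]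
    ring
-- Expectation values and the classical bound.
/-- For an operator `H` with `H² = c²`, the expectation value is real and bounded by `c`. -/
lemma IsDensityOperator.sq_re_trace_mul_le {n : Type*} [Fintype n] [DecidableEq n]
    {ρ H : Matrix n n ℂ} (hρ : IsDensityOperator ρ) (hH : H.IsHermitian) {m : ℝ}
    (h : H * H = (m : ℂ) • (1 : Matrix n n ℂ)) : (H * ρ).trace.re ^ 2 ≤ m := by
  set T := (H * ρ).trace.re with hT
  -- The variance of `H` is nonnegative, and it equals `m - T ^ 2`.
  have h0 := (hρ.1.mul_mul_conjTranspose_same (H - (T : ℂ) • 1)).trace_nonneg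
  have e : (H - (T : ℂ) • 1)ᴴ = H - (T : ℂ) • 1 := by
    rw [conjTranspose_sub, hH.eq, conjTranspose_smul]
    simp
  rw [e, trace_mul_comm, ← mul_assoc] at h0
  have e2 : (H - (T : ℂ) • 1) * (H - (T : ℂ) • 1) * ρ =
      ((m + T ^ 2 : ℝ) : ℂ) • ρ - ((2 * T : ℝ) : ℂ) • (H * ρ) := by
    simp only [sub_mul, mul_sub, h, smul_mul_assoc, mul_smul_comm, one_mul, mul_one]
    push_cast
    module
  rw [e2, trace_sub, trace_smul, trace_smul, hρ.2] at h0
  have h1 := (Complex.le_def.mp h0).1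
  simp only [Complex.zero_re, Complex.sub_re, smul_eq_mul, Complex.re_ofReal_mul, Complex.one_re,
    ← hT] at h1
  nlinarith

lemma IsDensityOperator.trace_mul_eq_re {n : Type*} [Fintype n]
    {ρ H : Matrix n n ℂ} (hρ : IsDensityOperator ρ) (hH : H.IsHermitian) :
    (H * ρ).trace = ((H * ρ).trace.re : ℂ) := by
  refine (Complex.conj_eq_iff_re.mp ?_).symm
  change star _ = _
  rw [← trace_conjTranspose, conjTranspose_mul, hH.eq, hρ.1.isHermitian.eq, trace_mul_comm]

lemma IsDensityOperator.norm_trace_mul_le {n : Type*} [Fintype n] [DecidableEq n]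
    {ρ H : Matrix n n ℂ} (hρ : IsDensityOperator ρ) (hH : H.IsHermitian) {c : ℝ} (hc : 0 ≤ c)
    (h : H * H = ((c ^ 2 : ℝ) : ℂ) • (1 : Matrix n n ℂ)) : ‖(H * ρ).trace‖ ≤ c := by
  rw [hρ.trace_mul_eq_re hH, Complex.norm_real]
  exact abs_le_of_sq_le_sq (hρ.sq_re_trace_mul_le hH h) hc

/-- The CHSH operator squares to `4` when the observables of one side commute. -/
lemma chsh_operator_mul_self {n m : Type*} [Fintype n] [Fintype m] [DecidableEq n] [DecidableEq m]
    {A₀ A₁ : Matrix n n ℂ} {B₀ B₁ : Matrix m m ℂ}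
    (hA₀ : A₀ * A₀ = 1) (hA₁ : A₁ * A₁ = 1) (hB₀ : B₀ * B₀ = 1) (hB₁ : B₁ * B₁ = 1)
    (h : A₁ * A₀ = A₀ * A₁ ∨ B₁ * B₀ = B₀ * B₁) :
    (A₀ ⊗ₖ B₀ + A₀ ⊗ₖ B₁ + A₁ ⊗ₖ B₀ - A₁ ⊗ₖ B₁) * (A₀ ⊗ₖ B₀ + A₀ ⊗ₖ B₁ + A₁ ⊗ₖ B₀ - A₁ ⊗ₖ B₁) =
      (4 : ℂ) • 1 := by
  -- In general the square differs from 4 by `[A₀, A₁] ⊗ [B₀, B₁]` up to sign, so one vanishing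
  -- commutator suffices.
  rcases h with h | h <;>
  · simp only [add_mul, mul_add, sub_mul, mul_sub, ← mul_kronecker_mul, hA₀, hA₁, hB₀, hB₁, h,
      one_kronecker_one]
    module

/-! ### The CHSH bound as geometry in `ℝ³`. -/

/-- Bessel's inequality for two orthogonal vectors of `ℝ³`, in homogeneous form. -/
lemma bessel_two {p q : Fin 3 → ℝ} (hpq : p ⬝ᵥ q = 0) (r : Fin 3 → ℝ) :
    (q ⬝ᵥ q) * (r ⬝ᵥ p) ^ 2 + (p ⬝ᵥ p) * (r ⬝ᵥ q) ^ 2 ≤ (p ⬝ᵥ p) * (q ⬝ᵥ q) * (r ⬝ᵥ r) := by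
  have h : (p ⬝ᵥ p) * (q ⬝ᵥ q) * (r ⬝ᵥ r) -
      ((q ⬝ᵥ q) * (r ⬝ᵥ p) ^ 2 + (p ⬝ᵥ p) * (r ⬝ᵥ q) ^ 2) =
      (r ⬝ᵥ (crossProduct p q)) ^ 2 +
        (p ⬝ᵥ q) * ((r ⬝ᵥ r) * (p ⬝ᵥ q) - 2 * (r ⬝ᵥ p) * (r ⬝ᵥ q)) := by
    simp [dotProduct, Fin.sum_univ_succ, crossProduct]
    ring
  rw [hpq, zero_mul, add_zero] at h
  nlinarith [sq_nonneg (r ⬝ᵥ (crossProduct p q))]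

/-- The action of dephasing on Bloch vectors. -/
def blochScale (s : ℝ) (v : Fin 3 → ℝ) : Fin 3 → ℝ := ![s * v 0, s * v 1, v 2]

lemma blochScale_dotProduct (s : ℝ) (u v : Fin 3 → ℝ) :
    blochScale s u ⬝ᵥ v = u ⬝ᵥ blochScale s v := by
  simp [blochScale, dotProduct, Fin.sum_univ_succ]
  ring

lemma blochScale_dotProduct_self (s : ℝ) (v : Fin 3 → ℝ) :
    blochScale s v ⬝ᵥ blochScale s v = s ^ 2 * (v ⬝ᵥ v) + (1 - s ^ 2) * v 2 ^ 2 := by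
  simp [blochScale, dotProduct, Fin.sum_univ_succ]
  ring

lemma blochScale_add (s : ℝ) (u v : Fin 3 → ℝ) :
    blochScale s (u + v) = blochScale s u + blochScale s v := by
  ext i
  fin_cases i <;> simp [blochScale] <;> ring

lemma blochScale_sub (s : ℝ) (u v : Fin 3 → ℝ) :
    blochScale s (u - v) = blochScale s u - blochScale s v := by
  ext i
  fin_cases i <;> simp [blochScale] <;> ring

lemma sq_apply_le_dotProduct_self (v : Fin 3 → ℝ) (i : Fin 3) : v i ^ 2 ≤ v ⬝ᵥ v := by
  rw [dotProduct, sq]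
  exact Finset.single_le_sum (f := fun i => v i * v i) (fun j _ => mul_self_nonneg (v j))
    (Finset.mem_univ i)

lemma blochScale_dotProduct_self_le {s : ℝ} (hs : s ^ 2 ≤ 1) (v : Fin 3 → ℝ) :
    blochScale s v ⬝ᵥ blochScale s v ≤ v ⬝ᵥ v := by
  rw [blochScale_dotProduct_self]
  nlinarith [sq_apply_le_dotProduct_self v 2]

lemma sq_dotProduct_le (u v : Fin 3 → ℝ) : (u ⬝ᵥ v) ^ 2 ≤ (u ⬝ᵥ u) * (v ⬝ᵥ v) := by
  simpa [dotProduct, sq] using Finset.sum_mul_sq_le_sq_mul_sq Finset.univ u v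

/-- Test the bilinear bound on `u = R *ᵥ v` and cancel one factor `|R v|²`. -/
lemma dotProduct_self_mulVec_le {R : Matrix (Fin 3) (Fin 3) ℝ}
    (hR : ∀ u v, (u ⬝ᵥ R *ᵥ v) ^ 2 ≤ (u ⬝ᵥ u) * (v ⬝ᵥ v)) (v : Fin 3 → ℝ) :
    (R *ᵥ v) ⬝ᵥ (R *ᵥ v) ≤ v ⬝ᵥ v := by
  have h := hR (R *ᵥ v) v
  have h0 : 0 ≤ (R *ᵥ v) ⬝ᵥ (R *ᵥ v) := by
    simpa using dotProduct_star_self_nonneg (R *ᵥ v)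
  have h1 : 0 ≤ v ⬝ᵥ v := by simpa using dotProduct_star_self_nonneg v
  nlinarith

lemma contraction_transpose {R : Matrix (Fin 3) (Fin 3) ℝ}
    (hR : ∀ u v, (u ⬝ᵥ R *ᵥ v) ^ 2 ≤ (u ⬝ᵥ u) * (v ⬝ᵥ v)) (u v : Fin 3 → ℝ) :
    (u ⬝ᵥ Rᵀ *ᵥ v) ^ 2 ≤ (u ⬝ᵥ u) * (v ⬝ᵥ v) := by
  rw [mulVec_transpose, dotProduct_comm, ← dotProduct_mulVec, mul_comm]
  exact hR v u

/-- The sum of the squared lengths of the images of two orthonormal vectors under the dephased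
correlation matrix, in homogeneous form. -/
lemma scaled_image_bound {R : Matrix (Fin 3) (Fin 3) ℝ}
    (hR : ∀ u v, (u ⬝ᵥ R *ᵥ v) ^ 2 ≤ (u ⬝ᵥ u) * (v ⬝ᵥ v)) {s t : ℝ} (hs : s ^ 2 ≤ 1)
    (ht : t ^ 2 ≤ 1) {p q : Fin 3 → ℝ} (hpq : p ⬝ᵥ q = 0) :
    (q ⬝ᵥ q) * (blochScale s (R *ᵥ blochScale t p) ⬝ᵥ blochScale s (R *ᵥ blochScale t p)) +
      (p ⬝ᵥ p) * (blochScale s (R *ᵥ blochScale t q) ⬝ᵥ blochScale s (R *ᵥ blochScale t q)) ≤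
      (p ⬝ᵥ p) * (q ⬝ᵥ q) * (1 + s ^ 2 * t ^ 2) := by
  set e : Fin 3 → ℝ := ![0, 0, 1] with he
  have hee : e ⬝ᵥ e = 1 := by simp [he, dotProduct, Fin.sum_univ_succ]
  have hev (v : Fin 3 → ℝ) : v 2 = e ⬝ᵥ v := by simp [he, dotProduct, Fin.sum_univ_succ]
  -- The vector representing the third coordinate of `R D_t v`, the only coordinate that `D_s`
  -- leaves unscaled.
  set r := blochScale t (Rᵀ *ᵥ e) with hr
  have hrv (v : Fin 3 → ℝ) : (R *ᵥ blochScale t v) 2 = r ⬝ᵥ v := by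
    rw [hev (R *ᵥ blochScale t v), hr, blochScale_dotProduct, mulVec_transpose, ← dotProduct_mulVec]
  have hr1 : r ⬝ᵥ r ≤ 1 := by
    refine (blochScale_dotProduct_self_le ht _).trans ?_
    simpa [hee] using dotProduct_self_mulVec_le (contraction_transpose hR) e
  have hp0 : 0 ≤ p ⬝ᵥ p := by simpa using dotProduct_star_self_nonneg p
  have hq0 : 0 ≤ q ⬝ᵥ q := by simpa using dotProduct_star_self_nonneg q
  have hb := (bessel_two hpq r).trans
    (mul_le_of_le_one_right (mul_nonneg hp0 hq0) hr1)
  have hb' := bessel_two hpq e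
  rw [hee, ← hev p, ← hev q, mul_one] at hb'
  have hp1 := dotProduct_self_mulVec_le hR (blochScale t p)
  have hq1 := dotProduct_self_mulVec_le hR (blochScale t q)
  rw [blochScale_dotProduct_self t] at hp1 hq1
  rw [blochScale_dotProduct_self s, blochScale_dotProduct_self s, hrv, hrv]
  -- For unit `p`, `q` the coefficients add up to `2s²t² + s²(1 - t²) + (1 - s²) = 1 + s²t²`:
  -- contractivity gives the first term, Bessel against `e` the second, Bessel against `r` the
  -- third.
  have k1 := mul_le_mul_of_nonneg_left hp1 (mul_nonneg (sq_nonneg s) hq0)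
  have k2 := mul_le_mul_of_nonneg_left hq1 (mul_nonneg (sq_nonneg s) hp0)
  have k3 := mul_le_mul_of_nonneg_left hb (sub_nonneg.mpr hs)
  have k4 := mul_le_mul_of_nonneg_left hb' (mul_nonneg (sq_nonneg s) (sub_nonneg.mpr ht))
  linarith

/-- The dephased CHSH bound for a contractive correlation matrix. -/
lemma chsh_vector_bound {R : Matrix (Fin 3) (Fin 3) ℝ}
    (hR : ∀ u v, (u ⬝ᵥ R *ᵥ v) ^ 2 ≤ (u ⬝ᵥ u) * (v ⬝ᵥ v)) {s t : ℝ} (hs : s ^ 2 ≤ 1)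
    (ht : t ^ 2 ≤ 1) {a₀ a₁ b₀ b₁ : Fin 3 → ℝ} (ha₀ : a₀ ⬝ᵥ a₀ = 1) (ha₁ : a₁ ⬝ᵥ a₁ = 1)
    (hb₀ : b₀ ⬝ᵥ b₀ = 1) (hb₁ : b₁ ⬝ᵥ b₁ = 1) :
    (blochScale s a₀ ⬝ᵥ R *ᵥ blochScale t b₀ + blochScale s a₀ ⬝ᵥ R *ᵥ blochScale t b₁ +
      blochScale s a₁ ⬝ᵥ R *ᵥ blochScale t b₀ - blochScale s a₁ ⬝ᵥ R *ᵥ blochScale t b₁) ^ 2 ≤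
      4 * (1 + s ^ 2 * t ^ 2) := by
  set p := b₀ + b₁ with hp
  set q := b₀ - b₁ with hq
  have hc := dotProduct_comm b₀ b₁
  have hpq : p ⬝ᵥ q = 0 := by
    simp only [hp, hq, add_dotProduct, dotProduct_sub, hb₀, hb₁, hc]
    ring
  have hsum : p ⬝ᵥ p + q ⬝ᵥ q = 4 := by
    simp only [hp, hq, add_dotProduct, dotProduct_sub, sub_dotProduct, dotProduct_add, hb₀, hb₁, hc]
    ring
  have e : blochScale s a₀ ⬝ᵥ R *ᵥ blochScale t b₀ + blochScale s a₀ ⬝ᵥ R *ᵥ blochScale t b₁ +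
      blochScale s a₁ ⬝ᵥ R *ᵥ blochScale t b₀ - blochScale s a₁ ⬝ᵥ R *ᵥ blochScale t b₁ =
      a₀ ⬝ᵥ blochScale s (R *ᵥ blochScale t p) + a₁ ⬝ᵥ blochScale s (R *ᵥ blochScale t q) := by
    rw [← blochScale_dotProduct, ← blochScale_dotProduct, hp, hq, blochScale_add, blochScale_sub,
      mulVec_add, mulVec_sub, dotProduct_add, dotProduct_sub]
    ring
  rw [e]
  have hα := sq_dotProduct_le a₀ (blochScale s (R *ᵥ blochScale t p))
  have hβ := sq_dotProduct_le a₁ (blochScale s (R *ᵥ blochScale t q))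
  rw [ha₀, one_mul] at hα
  rw [ha₁, one_mul] at hβ
  have hbound := scaled_image_bound hR hs ht hpq
  have hc1 (v : Fin 3 → ℝ) :
      blochScale s (R *ᵥ blochScale t v) ⬝ᵥ blochScale s (R *ᵥ blochScale t v) ≤ v ⬝ᵥ v :=
    (blochScale_dotProduct_self_le hs _).trans
      ((dotProduct_self_mulVec_le hR _).trans (blochScale_dotProduct_self_le ht v))
  have hp1 := hα.trans (hc1 p)
  have hq1 := hβ.trans (hc1 q)
  have hp0 : 0 ≤ p ⬝ᵥ p := by simpa using dotProduct_star_self_nonneg p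
  have hq0 : 0 ≤ q ⬝ᵥ q := by simpa using dotProduct_star_self_nonneg q
  set α := a₀ ⬝ᵥ blochScale s (R *ᵥ blochScale t p)
  set β := a₁ ⬝ᵥ blochScale s (R *ᵥ blochScale t q)
  have hst : 0 ≤ s ^ 2 * t ^ 2 := by positivity
  have k := (add_le_add (mul_le_mul_of_nonneg_left hα hq0)
    (mul_le_mul_of_nonneg_left hβ hp0)).trans hbound
  clear hbound hα hβ hc1 e
  generalize p ⬝ᵥ p = x at *
  generalize q ⬝ᵥ q = y at *
  -- If `p` or `q` vanishes, the homogeneous bound is void; the other term alone has square at most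
  -- 4.
  rcases hp0.eq_or_lt with h | hx
  · have : α = 0 := by nlinarith
    rw [this, zero_add]
    linarith
  rcases hq0.eq_or_lt with h | hy
  · have : β = 0 := by nlinarith
    rw [this, add_zero]
    linarith
  refine le_of_mul_le_mul_left ?_ (mul_pos hx hy)
  -- Weighted Cauchy–Schwarz with explicit defect; the 4 is `x + y`.
  have hid : 4 * (y * α ^ 2 + x * β ^ 2) - x * y * (α + β) ^ 2 = (α * y - β * x) ^ 2 := by
    rw [← hsum]
    ring
  linarith [sq_nonneg (α * y - β * x)]

/-! ### Moving the noise onto the observables; the correlation matrix. -/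

lemma trace_mul_hadamard {n : Type*} [Fintype n] (A W ρ : Matrix n n ℂ) :
    (A * (W ⊙ ρ)).trace = ((Wᵀ ⊙ A) * ρ).trace := by
  simp only [Matrix.trace, Matrix.diag_apply, Matrix.mul_apply, Matrix.hadamard_apply,
    Matrix.transpose_apply]
  refine Finset.sum_congr rfl fun i _ => Finset.sum_congr rfl fun j _ => ?_
  ring

lemma dephasingMultiplier_transpose (s : ℝ) :
    (dephasingMultiplier s)ᵀ = dephasingMultiplier s := by
  ext i j
  fin_cases i <;> fin_cases j <;> simp [dephasingMultiplier]

lemma dephasingMultiplier_hadamard_pauliVec (s : ℝ) (v : Fin 3 → ℝ) :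
    dephasingMultiplier s ⊙ pauliVec v = pauliVec (blochScale s v) := by
  ext i j
  fin_cases i <;> fin_cases j <;> simp [dephasingMultiplier, pauliVec, blochScale] <;> ring

lemma dephasingMultiplier_posSemidef {s : ℝ} (hs : s ^ 2 ≤ 1) :
    (dephasingMultiplier s).PosSemidef := by
  have h1 : (Real.sqrt (1 - s ^ 2) : ℂ) * Real.sqrt (1 - s ^ 2) = 1 - s ^ 2 := by
    rw [← Complex.ofReal_mul, Real.mul_self_sqrt (by linarith)]
    simp
  have e : dephasingMultiplier s =
      !![1, (s : ℂ); 0, (Real.sqrt (1 - s ^ 2) : ℂ)]ᴴ *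
        !![1, (s : ℂ); 0, (Real.sqrt (1 - s ^ 2) : ℂ)] := by
    ext i j
    fin_cases i <;> fin_cases j <;>
      simp [dephasingMultiplier, Matrix.mul_apply, Fin.sum_univ_two, h1]
    ring
  rw [e]
  exact posSemidef_conjTranspose_mul_self _

/-- Positivity is the Schur product theorem. It allows the classical bound to be applied directly to
the dephased state. -/
lemma IsDensityOperator.hadamard {n : Type*} [Fintype n] {ρ W : Matrix n n ℂ}
    (hρ : IsDensityOperator ρ) (hW : W.PosSemidef) (h1 : ∀ i, W i i = 1) :
    IsDensityOperator (W ⊙ ρ) := by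
  refine ⟨hW.hadamard hρ.1, ?_⟩
  rw [← hρ.2]
  simp [Matrix.trace, h1]

lemma chshScore_eq_norm_trace (ρ : TwoQubitOp) (A B : Fin 2 → PVM ℤˣ (Fin 2)) :
    chshScore ρ A B =
      ‖(((A 0).observable ⊗ₖ (B 0).observable + (A 0).observable ⊗ₖ (B 1).observable +
        (A 1).observable ⊗ₖ (B 0).observable - (A 1).observable ⊗ₖ (B 1).observable) *
          ρ).trace‖ := by
  simp only [chshScore, correlator, Fin.sum_univ_two, add_mul, sub_mul, trace_add, trace_sub]
  congr 1
  simp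
  ring

/-- When the observables of one side commute, the score is at most the classical bound `2`. -/
lemma chshScore_le_two_of_commute {ρ : TwoQubitOp} (hρ : IsDensityOperator ρ)
    (A B : Fin 2 → PVM ℤˣ (Fin 2))
    (h : (A 1).observable * (A 0).observable = (A 0).observable * (A 1).observable ∨
      (B 1).observable * (B 0).observable = (B 0).observable * (B 1).observable) :
    chshScore ρ A B ≤ 2 := by
  rw [chshScore_eq_norm_trace]
  have hK (i j : Fin 2) : ((A i).observable ⊗ₖ (B j).observable).IsHermitian := by
    rw [Matrix.IsHermitian, conjTranspose_kronecker, (A i).observable_isHermitian.eq,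
      (B j).observable_isHermitian.eq]
  refine hρ.norm_trace_mul_le ((((hK 0 0).add (hK 0 1)).add (hK 1 0)).sub (hK 1 1)) zero_le_two ?_
  rw [chsh_operator_mul_self (A 0).observable_mul_self (A 1).observable_mul_self
    (B 0).observable_mul_self (B 1).observable_mul_self h]
  norm_num

/-- The correlation matrix of the Pauli observables. -/
noncomputable def correlationMatrix (ρ : TwoQubitOp) : Matrix (Fin 3) (Fin 3) ℝ :=
  Matrix.of fun i j =>
    ((pauliVec (Pi.single i 1) ⊗ₖ pauliVec (Pi.single j 1)) * ρ).trace.re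

lemma pauliVec_eq_sum (v : Fin 3 → ℝ) :
    pauliVec v = ∑ i, (v i : ℂ) • pauliVec (Pi.single i 1) := by
  ext i j
  fin_cases i <;> fin_cases j <;> simp [pauliVec, Fin.sum_univ_succ] <;> ring

lemma re_trace_pauliVec (ρ : TwoQubitOp) (u v : Fin 3 → ℝ) :
    ((pauliVec u ⊗ₖ pauliVec v) * ρ).trace.re = u ⬝ᵥ correlationMatrix ρ *ᵥ v := by
  rw [pauliVec_eq_sum u, pauliVec_eq_sum v]
  simp only [correlationMatrix, dotProduct, mulVec, Matrix.of_apply, Fin.sum_univ_three,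
    add_kronecker, kronecker_add, smul_kronecker, kronecker_smul, add_mul, smul_mul_assoc,
    trace_add, trace_smul, Complex.add_re, smul_eq_mul, Complex.re_ofReal_mul]
  ring

lemma pauliVec_kronecker_isHermitian (u v : Fin 3 → ℝ) :
    (pauliVec u ⊗ₖ pauliVec v).IsHermitian := by
  rw [Matrix.IsHermitian, conjTranspose_kronecker, (pauliVec_isHermitian u).eq,
    (pauliVec_isHermitian v).eq]

lemma IsDensityOperator.trace_pauliVec {ρ : TwoQubitOp} (hρ : IsDensityOperator ρ)
    (u v : Fin 3 → ℝ) :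
    ((pauliVec u ⊗ₖ pauliVec v) * ρ).trace = ((u ⬝ᵥ correlationMatrix ρ *ᵥ v : ℝ) : ℂ) := by
  rw [hρ.trace_mul_eq_re (pauliVec_kronecker_isHermitian u v), re_trace_pauliVec]

/-- The operator `pauliVec u ⊗ₖ pauliVec v` squares to `|u|²|v|²`, which bounds its squared
expectation. -/
lemma IsDensityOperator.correlationMatrix_contraction {ρ : TwoQubitOp}
    (hρ : IsDensityOperator ρ) (u v : Fin 3 → ℝ) :
    (u ⬝ᵥ correlationMatrix ρ *ᵥ v) ^ 2 ≤ (u ⬝ᵥ u) * (v ⬝ᵥ v) := by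
  rw [← re_trace_pauliVec]
  refine hρ.sq_re_trace_mul_le (pauliVec_kronecker_isHermitian u v) ?_
  rw [← mul_kronecker_mul, pauliVec_mul_self, pauliVec_mul_self, smul_kronecker, kronecker_smul,
    one_kronecker_one, smul_smul, Complex.ofReal_mul]

lemma trace_pauliVec_dephased (ρ : TwoQubitOp) (s t : ℝ) (u v : Fin 3 → ℝ) :
    ((pauliVec u ⊗ₖ pauliVec v) *
      ((dephasingMultiplier s ⊗ₖ dephasingMultiplier t) ⊙ ρ)).trace =
      ((pauliVec (blochScale s u) ⊗ₖ pauliVec (blochScale t v)) * ρ).trace := by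
  rw [trace_mul_hadamard, ← dephasingMultiplier_hadamard_pauliVec,
    ← dephasingMultiplier_hadamard_pauliVec, ← kroneckerMap_transpose,
    dephasingMultiplier_transpose, dephasingMultiplier_transpose, kronecker_hadamard_kronecker]

/-- The dephased score of Pauli measurements in terms of the correlation matrix. -/
lemma IsDensityOperator.chshScore_dephased {ρ : TwoQubitOp} (hρ : IsDensityOperator ρ) (s t : ℝ)
    {A B : Fin 2 → PVM ℤˣ (Fin 2)} {a b : Fin 2 → Fin 3 → ℝ}
    (hA : ∀ i, (A i).observable = pauliVec (a i)) (hB : ∀ i, (B i).observable = pauliVec (b i)) :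
    chshScore ((dephasingMultiplier s ⊗ₖ dephasingMultiplier t) ⊙ ρ) A B =
      |blochScale s (a 0) ⬝ᵥ correlationMatrix ρ *ᵥ blochScale t (b 0) +
        blochScale s (a 0) ⬝ᵥ correlationMatrix ρ *ᵥ blochScale t (b 1) +
        blochScale s (a 1) ⬝ᵥ correlationMatrix ρ *ᵥ blochScale t (b 0) -
        blochScale s (a 1) ⬝ᵥ correlationMatrix ρ *ᵥ blochScale t (b 1)| := by
  simp only [chshScore_eq_norm_trace, hA, hB, add_mul, sub_mul, trace_add, trace_sub,
    trace_pauliVec_dephased, hρ.trace_pauliVec]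
  rw [← Real.norm_eq_abs, ← Complex.norm_real]
  push_cast
  rfl

/-! ### The upper bound and its attainment. -/

lemma chshScore_dephased_le {ρ : TwoQubitOp} (hρ : IsDensityOperator ρ) {s t : ℝ}
    (hs : s ^ 2 ≤ 1) (ht : t ^ 2 ≤ 1) (A B : Fin 2 → PVM ℤˣ (Fin 2)) :
    chshScore ((dephasingMultiplier s ⊗ₖ dephasingMultiplier t) ⊙ ρ) A B ≤
      2 * Real.sqrt (1 + s ^ 2 * t ^ 2) := by
  by_cases h : (A 1).observable * (A 0).observable = (A 0).observable * (A 1).observable ∨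
      (B 1).observable * (B 0).observable = (B 0).observable * (B 1).observable
  · have hσ : IsDensityOperator ((dephasingMultiplier s ⊗ₖ dephasingMultiplier t) ⊙ ρ) := by
      refine hρ.hadamard
        ((dephasingMultiplier_posSemidef hs).kronecker (dephasingMultiplier_posSemidef ht)) ?_
      rintro ⟨i, j⟩
      fin_cases i <;> fin_cases j <;> simp [dephasingMultiplier]
    have h1 : 1 ≤ Real.sqrt (1 + s ^ 2 * t ^ 2) :=
      Real.one_le_sqrt.mpr (by nlinarith [mul_nonneg (sq_nonneg s) (sq_nonneg t)])
    linarith [chshScore_le_two_of_commute hσ A B h]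
  · obtain ⟨hA, hB⟩ := not_or.mp h
    -- The observables `±1` commute with everything, so a noncommuting pair consists of Pauli
    -- observables.
    have key (P : Fin 2 → PVM ℤˣ (Fin 2))
        (hP : (P 1).observable * (P 0).observable ≠ (P 0).observable * (P 1).observable)
        (i : Fin 2) : ∃ v : Fin 3 → ℝ, v ⬝ᵥ v = 1 ∧ (P i).observable = pauliVec v := by
      refine (exists_pauliVec_of_mul_self_eq_one (P i).observable_isHermitian
        (P i).observable_mul_self).resolve_right fun hi => hP ?_
      fin_cases i <;> rcases hi with hi | hi <;> simp at hi <;> simp [hi]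
    choose a ha hAa using key A hA
    choose b hb hBb using key B hB
    rw [hρ.chshScore_dephased s t hAa hBb]
    refine abs_le_of_sq_le_sq ?_ (by positivity)
    rw [mul_pow, Real.sq_sqrt (by positivity)]
    linarith [chsh_vector_bound hρ.correlationMatrix_contraction hs ht (ha 0) (ha 1) (hb 0) (hb 1)]

/-- The Bell state `(|00⟩ + |11⟩) / √2`, as a density operator. -/
noncomputable def bellState : TwoQubitOp :=
  Matrix.of fun x y => if x.1 = x.2 ∧ y.1 = y.2 then 1 / 2 else 0

lemma bellState_isDensityOperator : IsDensityOperator bellState := by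
  constructor
  · have e : bellState = (1 / 2 : ℝ) •
        vecMulVec (fun x : Fin 2 × Fin 2 => if x.1 = x.2 then (1 : ℂ) else 0)
          (star fun x : Fin 2 × Fin 2 => if x.1 = x.2 then (1 : ℂ) else 0) := by
      ext x y
      by_cases hx : x.1 = x.2 <;> by_cases hy : y.1 = y.2 <;>
        simp [bellState, vecMulVec_apply, hx, hy]
    rw [e]
    exact (posSemidef_vecMulVec_self_star _).smul (by norm_num)
  · simp [bellState, Matrix.trace, Fintype.sum_prod_type]

lemma correlationMatrix_bellState : correlationMatrix bellState = Matrix.diagonal ![1, -1, 1] := by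
  ext i j
  fin_cases i <;> fin_cases j <;>
    simp [correlationMatrix, bellState, pauliVec, Matrix.trace, Matrix.mul_apply,
      Fintype.sum_prod_type, Fin.sum_univ_two, Pi.single_apply] <;> norm_num

/-- The optimal strategy: the Bell state, `Z` and `X` on the first qubit, and two observables
in the `X`-`Z` plane on the second one. -/
lemma exists_chshScore_dephased_eq (s t : ℝ) : ∃ A B : Fin 2 → PVM ℤˣ (Fin 2),
    chshScore ((dephasingMultiplier s ⊗ₖ dephasingMultiplier t) ⊙ bellState) A B =
      2 * Real.sqrt (1 + s ^ 2 * t ^ 2) := by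
  set c := Real.sqrt (1 + s ^ 2 * t ^ 2) with hc
  have hpos : 0 < 1 + s ^ 2 * t ^ 2 := by positivity
  have hc2 : c ^ 2 = 1 + s ^ 2 * t ^ 2 := Real.sq_sqrt hpos.le
  have hc0 : 0 < c := Real.sqrt_pos.mpr hpos
  let a : Fin 2 → Fin 3 → ℝ := ![![0, 0, 1], ![1, 0, 0]]
  -- With `M = diag(st, -st, 1)`, these are the normalizations of `Mᵀ(a₀ + a₁)` and `Mᵀ(a₀ - a₁)`,
  -- both of length `c`; the score is therefore `2c`.
  let b : Fin 2 → Fin 3 → ℝ := ![![s * t / c, 0, 1 / c], ![-(s * t / c), 0, 1 / c]]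
  have ha (i : Fin 2) : a i ⬝ᵥ a i = 1 := by
    fin_cases i <;> simp [a, dotProduct, Fin.sum_univ_three]
  have hb (i : Fin 2) : b i ⬝ᵥ b i = 1 := by
    fin_cases i <;> simp [b, dotProduct, Fin.sum_univ_three] <;> field_simp <;> linarith
  refine ⟨fun i => pauliPVM (a i) (ha i), fun i => pauliPVM (b i) (hb i), ?_⟩
  rw [bellState_isDensityOperator.chshScore_dephased s t
    (fun i => pauliPVM_observable (a i) (ha i)) (fun i => pauliPVM_observable (b i) (hb i)),
    correlationMatrix_bellState, ← abs_of_pos (mul_pos two_pos hc0)]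
  congr 1
  simp [a, b, blochScale, dotProduct, Fin.sum_univ_three, mulVec_diagonal]
  field_simp
  linarith

theorem proposition1 (γ₁ γ₂ : ℝ) (hγ₁ : γ₁ ∈ Set.Icc (0 : ℝ) 1) (hγ₂ : γ₂ ∈ Set.Icc (0 : ℝ) 1) :
    IsGreatest (chshScores (tensorMap (dephasing γ₁) (dephasing γ₂)))
      (2 * Real.sqrt (1 + (1 - γ₁) * (1 - γ₂))) := by
  have hN := tensorMap_eq_hadamard (dephasing_apply hγ₁) (dephasing_apply hγ₂)
  have hs : Real.sqrt (1 - γ₁) ^ 2 = 1 - γ₁ := Real.sq_sqrt (by linarith [hγ₁.2])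
  have ht : Real.sqrt (1 - γ₂) ^ 2 = 1 - γ₂ := Real.sq_sqrt (by linarith [hγ₂.2])
  rw [← hs, ← ht]
  constructor
  · obtain ⟨A, B, h⟩ := exists_chshScore_dephased_eq (Real.sqrt (1 - γ₁)) (Real.sqrt (1 - γ₂))
    exact ⟨bellState, bellState_isDensityOperator, A, B, by rw [hN, h]⟩
  · rintro _ ⟨ρ, hρ, A, B, rfl⟩
    rw [hN]
    exact chshScore_dephased_le hρ (by rw [hs]; linarith [hγ₁.1]) (by rw [ht]; linarith [hγ₂.1]) A B
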